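/- Let $n\ge 0$ and let $\Theta$ be a real polynomial of total degree at most $2$ in $n$ variables. Identify the discrete cube $Q_n=\{0,1\}^n$ with the family of subsets of $[n]=\{1,\dots,n\}$ via indicator vectors; two vertices are neighbours if they differ in exactly one coordinate. Call $A\subseteq[n]$ a local maximum of $\Theta$ on $Q_n$ if the value of $\Theta$ at $A$ is strictly larger than its value at every neighbour of $A$, and let $\mathcal F$ be the family of all local maxima of $\Theta$ on $Q_n$. Put $c=0$ if $n$ is odd and $c=1$ if $n$ is even. If $$|\mathcal F|>\left(1-\frac{1}{n-c}\right)\binom{n}{\lfloor n/2\rfloor},$$ then there is a set $S\subseteq[n]$ such that, after applying the automorphism $A\mapsto A\,\Delta\,S$ of $Q_n$, the family $\{A\,\Delta\,S: A\in\mathcal F\}$ is an antichain with respect to inclusion. -/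

import Mathlib

open scoped symmDiff

/-- The vertex of the discrete cube `{0,1}^n` in `ℝ^n` that corresponds to `A ⊆ [n]`:
its indicator vector. -/
def cubeVertex {n : ℕ} (A : Finset (Fin n)) : Fin n → ℝ :=
  fun i => if i ∈ A then 1 else 0

/-- Two vertices of the cube are neighbours if they differ in exactly one coordinate. -/
def CubeAdj {n : ℕ} (A B : Finset (Fin n)) : Prop :=
  (A ∆ B).card = 1

/-- `A` is a strict local maximum of the polynomial function `Θ` on the cube: the value at `A`
is strictly larger than the value at every neighbour of `A`. -/
def IsStrictLocalMaxOnCube {n : ℕ} (Θ : MvPolynomial (Fin n) ℝ) (A : Finset (Fin n)) : Prop :=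
  ∀ B : Finset (Fin n), CubeAdj A B →
    MvPolynomial.eval (cubeVertex B) Θ < MvPolynomial.eval (cubeVertex A) Θ

/-- The set of strict local maxima of `Θ` on the cube, as a family of subsets of `[n]`. -/
def localMaxima {n : ℕ} (Θ : MvPolynomial (Fin n) ℝ) : Set (Finset (Fin n)) :=
  {A | IsStrictLocalMaxOnCube Θ A}

/-!
For each direction `i`, strict local maximality determines the sign of the change of `Θ` along the
edge in direction `i`. If `J` is the symmetric matrix of the mixed second derivatives of `Θ`,
subtracting these conditions at two local maxima `A ≠ B` shows that the quadratic form of `J` is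
positive at `1_A - 1_B`. Hence a family of vertices on which this form is nonpositive contains at
most one local maximum; such families behave like chains, and adjoining a coordinate splits the
double of a chain of length `s` into chains of lengths `s + 1` and `s - 1`.

Suppose `J i j * J i k * J j k ≥ 0` for distinct `i, j, k`. Up to switching signs, all three entries
are nonnegative, which makes the ball of radius one about a suitable vertex of the cube on
`{i, j, k}` a chain of length `4`, and likewise the antipodal ball. The two balls cover that cube,
so there are at most twice as many local maxima as the sum of the `4` middle binomial coefficients
of order `n - 3`, which is exactly the given threshold. Above the threshold all triple products are
therefore negative. Then `J` can be switched to be entrywise nonpositive by some `S`, and this is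
incompatible with `A ∆ S ⊂ B ∆ S` for two local maxima.
-/

section MiddleBinomials

open Finset

/-- The sum of the `s` middle binomial coefficients of order `m`, which is the number of chains in a
symmetric decomposition of the product of a chain of length `s` with the cube of dimension `m`.
For `s > m + 1` the subtraction truncates, so that the sum runs over all `j < (m + 1 + s) / 2` and
equals `2 ^ m`. -/
def middleChooseSum (m s : ℕ) : ℕ :=
  ∑ j ∈ Ico ((m + 1 - s) / 2) ((m + 1 + s) / 2), m.choose j

lemma middleChooseSum_zero_right (m : ℕ) : middleChooseSum m 0 = 0 := by
  simp [middleChooseSum]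

lemma middleChooseSum_one_right (m : ℕ) : middleChooseSum m 1 = m.choose (m / 2) := by
  rw [middleChooseSum, show (m + 1 + 1) / 2 = m / 2 + 1 by omega]
  simp

lemma middleChooseSum_zero_succ (s : ℕ) : middleChooseSum 0 (s + 1) = 1 := by
  have hpos : 0 < (0 + 1 + (s + 1)) / 2 := by omega
  rw [middleChooseSum, show (0 + 1 - (s + 1)) / 2 = 0 by omega,
    sum_eq_single_of_mem 0 (by simpa using hpos) fun j _ hj ↦ Nat.choose_eq_zero_of_lt (by omega),
    Nat.choose_zero_right]

lemma sum_Ico_choose_succ (m : ℕ) {a b : ℕ} (hab : a ≤ b) :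
    ∑ j ∈ Ico a (b + 1), (m + 1).choose j =
      ∑ j ∈ Ico (a - 1) (b + 1), m.choose j + ∑ j ∈ Ico a b, m.choose j := by
  induction b, hab using Nat.le_induction with
  | base =>
    cases a with
    | zero => simp
    | succ a => simp [sum_Ico_succ_top, Nat.choose_succ_succ]
  | succ b hab ih =>
    rw [sum_Ico_succ_top (by omega), ih, sum_Ico_succ_top (by omega : a - 1 ≤ b + 1),
      sum_Ico_succ_top hab, Nat.choose_succ_succ]
    ring

lemma middleChooseSum_succ_succ (m s : ℕ) :
    middleChooseSum (m + 1) (s + 1) = middleChooseSum m (s + 2) + middleChooseSum m s := by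
  have hab : (m + 1 - s) / 2 ≤ (m + 1 + s) / 2 := by omega
  rw [middleChooseSum, middleChooseSum, middleChooseSum,
    show (m + 1 + 1 - (s + 1)) / 2 = (m + 1 - s) / 2 by omega,
    show (m + 1 + 1 + (s + 1)) / 2 = (m + 1 + s) / 2 + 1 by omega,
    show (m + 1 - (s + 2)) / 2 = (m + 1 - s) / 2 - 1 by omega,
    show (m + 1 + (s + 2)) / 2 = (m + 1 + s) / 2 + 1 by omega]
  exact sum_Ico_choose_succ m hab

lemma middleChooseSum_four_add (m : ℕ) :
    middleChooseSum m 4 + 2 * (m + 1).choose ((m + 1) / 2) = (m + 3).choose ((m + 3) / 2) := by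
  simp only [← middleChooseSum_one_right, middleChooseSum_succ_succ, middleChooseSum_zero_right]
  ring

lemma centralBinom_succ_eq_two_mul (p : ℕ) :
    (p + 1).centralBinom = 2 * (2 * p + 1).choose p := by
  rw [Nat.centralBinom, show 2 * (p + 1) = 2 * p + 1 + 1 by ring, Nat.choose_succ_succ,
    Nat.choose_symm_half]
  ring

lemma choose_half_add_three (m : ℕ) :
    (m / 2 + 2) * (m + 3).choose ((m + 3) / 2) =
      2 * (2 * (m / 2) + 3) * (m + 1).choose ((m + 1) / 2) := by
  rcases Nat.even_or_odd' m with ⟨p, rfl | rfl⟩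
  · have h := Nat.succ_mul_centralBinom_succ (p + 1)
    rw [centralBinom_succ_eq_two_mul, centralBinom_succ_eq_two_mul,
      show 2 * (p + 1) + 1 = 2 * p + 3 by ring] at h
    rw [show 2 * p / 2 = p by omega, show (2 * p + 3) / 2 = p + 1 by omega,
      show (2 * p + 1) / 2 = p by omega]
    linarith
  · rw [show (2 * p + 1) / 2 = p by omega, show (2 * p + 1 + 3) / 2 = p + 2 by omega,
      show (2 * p + 1 + 1) / 2 = p + 1 by omega]
    exact Nat.succ_mul_centralBinom_succ (p + 1)

lemma add_three_sub_ite_odd (m : ℕ) :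
    ((m + 3 : ℕ) : ℝ) - (if Odd (m + 3) then 0 else 1) = 2 * (m / 2 : ℕ) + 3 := by
  rcases Nat.even_or_odd' m with ⟨p, rfl | rfl⟩
  · rw [if_pos ⟨p + 1, by ring⟩, show 2 * p / 2 = p by omega]
    push_cast
    ring
  · rw [if_neg (Nat.not_odd_iff_even.2 ⟨p + 2, by ring⟩), show (2 * p + 1) / 2 = p by omega]
    push_cast
    ring

lemma two_mul_middleChooseSum_four (m : ℕ) :
    ((2 * middleChooseSum m 4 : ℕ) : ℝ) =
      (1 - 1 / (((m + 3 : ℕ) : ℝ) - (if Odd (m + 3) then 0 else 1))) *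
        ((m + 3).choose ((m + 3) / 2) : ℝ) := by
  have hsum := congrArg (Nat.cast (R := ℝ)) (middleChooseSum_four_add m)
  have hrec := congrArg (Nat.cast (R := ℝ)) (choose_half_add_three m)
  rw [add_three_sub_ite_odd]
  push_cast at hsum hrec ⊢
  field_simp
  linear_combination 2 * (2 * ((m / 2 : ℕ) : ℝ) + 3) * hsum + 2 * hrec

end MiddleBinomials

section Form

open Matrix

lemma add_single_dotProduct_mulVec {ι R : Type*} [Fintype ι] [DecidableEq ι] [CommRing R]
    (J : Matrix ι ι R) (z : ι → R) (t : ι) (c : R) :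
    (z + Pi.single t c) ⬝ᵥ (J *ᵥ (z + Pi.single t c)) =
      z ⬝ᵥ (J *ᵥ z) + c * ((J + Jᵀ) *ᵥ z) t + c ^ 2 * J t t := by
  have hleft : z ⬝ᵥ (J *ᵥ Pi.single t c) = c * (Jᵀ *ᵥ z) t := by
    rw [dotProduct_mulVec, dotProduct_single, mulVec_transpose, mul_comm]
  have hdiag : (J *ᵥ Pi.single t c) t = J t t * c := dotProduct_single _ _ _
  rw [mulVec_add, dotProduct_add, add_dotProduct, add_dotProduct, single_dotProduct,
    single_dotProduct, hleft, hdiag, add_mulVec, Pi.add_apply]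
  ring

variable {n : ℕ} {J : Matrix (Fin n) (Fin n) ℝ}

/-- The value of the quadratic form with matrix `J` at the difference of two cube vertices. -/
def differenceForm (J : Matrix (Fin n) (Fin n) ℝ) (A B : Finset (Fin n)) : ℝ :=
  (cubeVertex A - cubeVertex B) ⬝ᵥ (J *ᵥ (cubeVertex A - cubeVertex B))

lemma differenceForm_comm (A B : Finset (Fin n)) :
    differenceForm J A B = differenceForm J B A := by
  unfold differenceForm
  rw [← neg_sub (cubeVertex B) (cubeVertex A), mulVec_neg, neg_dotProduct_neg]

lemma differenceForm_self (A : Finset (Fin n)) : differenceForm J A A = 0 := by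
  simp [differenceForm]

lemma cubeVertex_insert {A : Finset (Fin n)} {t : Fin n} (h : t ∉ A) :
    cubeVertex (insert t A) = cubeVertex A + Pi.single t 1 := by
  ext i
  rcases eq_or_ne i t with rfl | hi
  · simp [cubeVertex, h]
  · simp [cubeVertex, hi]

lemma differenceForm_insert_insert {A B : Finset (Fin n)} {t : Fin n} (hA : t ∉ A) (hB : t ∉ B) :
    differenceForm J (insert t A) (insert t B) = differenceForm J A B := by
  simp [differenceForm, cubeVertex_insert hA, cubeVertex_insert hB]

lemma differenceForm_insert_right {A B : Finset (Fin n)} {t : Fin n} (hB : t ∉ B) :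
    differenceForm J A (insert t B) = differenceForm J A B -
      (((J + Jᵀ) *ᵥ cubeVertex A) t - ((J + Jᵀ) *ᵥ cubeVertex B) t) + J t t := by
  have h : cubeVertex A - cubeVertex (insert t B) =
      cubeVertex A - cubeVertex B + Pi.single t (-1) := by
    rw [cubeVertex_insert hB, Pi.single_neg]
    abel
  rw [differenceForm, h, add_single_dotProduct_mulVec, mulVec_sub (J + Jᵀ), Pi.sub_apply,
    differenceForm]
  ring

/-- A family of vertices of the cube on which the difference form is nonpositive. It plays the role
of a chain: it shares at most one member with a family on which the difference form is positive. -/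
def IsFormChain (J : Matrix (Fin n) (Fin n) ℝ) (C : Finset (Finset (Fin n))) : Prop :=
  ∀ A ∈ C, ∀ B ∈ C, differenceForm J A B ≤ 0

namespace IsFormChain

variable {C D : Finset (Finset (Fin n))} {t : Fin n}

lemma subset (hD : IsFormChain J D) (h : C ⊆ D) : IsFormChain J C :=
  fun A hA B hB ↦ hD A (h hA) B (h hB)

lemma image_insert (hC : IsFormChain J C) (ht : ∀ A ∈ C, t ∉ A) :
    IsFormChain J (C.image (insert t)) := by
  simp only [IsFormChain, Finset.forall_mem_image]
  intro A hA B hB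
  rw [differenceForm_insert_insert (ht A hA) (ht B hB)]
  exact hC A hA B hB

lemma insert_of_forall_le (hC : IsFormChain J C) {B : Finset (Fin n)}
    (hB : ∀ A ∈ C, differenceForm J A B ≤ 0) : IsFormChain J (insert B C) := by
  simp only [IsFormChain, Finset.forall_mem_insert]
  exact ⟨⟨(differenceForm_self B).le, fun A hA ↦ differenceForm_comm B A ▸ hB A hA⟩,
    fun A hA ↦ ⟨hB A hA, hC A hA⟩⟩

lemma exists_insert_insert (hJ : J t t ≤ 0) (hC : IsFormChain J C) (hne : C.Nonempty)
    (ht : ∀ A ∈ C, t ∉ A) : ∃ M ∈ C, IsFormChain J (insert (insert t M) C) := by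
  obtain ⟨M, hM, hmin⟩ := C.exists_min_image (fun A ↦ ((J + Jᵀ) *ᵥ cubeVertex A) t) hne
  refine ⟨M, hM, hC.insert_of_forall_le fun A hA ↦ ?_⟩
  rw [differenceForm_insert_right (ht M hM)]
  linarith [hC A hA M hM, hmin A hA]

lemma exists_doubling (hJ : J t t ≤ 0) (hC : IsFormChain J C) (hne : C.Nonempty)
    (ht : ∀ A ∈ C, t ∉ A) :
    ∃ C₁ C₂ : Finset (Finset (Fin n)), IsFormChain J C₁ ∧ IsFormChain J C₂ ∧
      C₁.card = C.card + 1 ∧ C₂.card = C.card - 1 ∧ C₁ ∪ C₂ = C ∪ C.image (insert t) := by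
  obtain ⟨M, hM, hchain⟩ := hC.exists_insert_insert hJ hne ht
  have hinj : Set.InjOn (insert t) (C : Set (Finset (Fin n))) :=
    Finset.insert_erase_invOn.2.injOn.mono ht
  refine ⟨insert (insert t M) C, (C.erase M).image (insert t), hchain,
    (hC.image_insert ht).subset (Finset.image_subset_image (C.erase_subset M)), ?_, ?_, ?_⟩
  · exact Finset.card_insert_of_notMem fun h ↦ ht _ h (Finset.mem_insert_self t M)
  · rw [Finset.card_image_of_injOn (hinj.mono (C.erase_subset M)), Finset.card_erase_of_mem hM]
  · rw [Finset.insert_union, ← Finset.union_insert, ← Finset.image_insert, Finset.insert_erase hM]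

lemma card_filter_mem_le_one (hC : IsFormChain J C) {F : Finset (Finset (Fin n))}
    (hF : (F : Set (Finset (Fin n))).Pairwise fun A B ↦ 0 < differenceForm J A B) :
    (F.filter (· ∈ C)).card ≤ 1 := by
  rw [Finset.card_le_one]
  intro A hA B hB
  rw [Finset.mem_filter] at hA hB
  by_contra hAB
  exact (hF hA.1 hB.1 hAB).not_ge (hC A hA.2 B hB.2)

/-- Adding the missing coordinates to `T` one at a time, each chain of length `s` over `T` splits
into a chain of length `s + 1` and one of length `s - 1`, as in the symmetric chain decomposition
of the cube. -/
lemma card_filter_inter_mem_le (hJ : ∀ i, J i i ≤ 0) {F : Finset (Finset (Fin n))}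
    (hF : (F : Set (Finset (Fin n))).Pairwise fun A B ↦ 0 < differenceForm J A B)
    {T : Finset (Fin n)} (hC : IsFormChain J C) (hCT : ∀ A ∈ C, A ⊆ T) :
    (F.filter (· ∩ T ∈ C)).card ≤ middleChooseSum Tᶜ.card C.card := by
  induction hm : Tᶜ.card generalizing T C with
  | zero =>
    obtain rfl : T = Finset.univ := by simpa using hm
    rcases C.eq_empty_or_nonempty with rfl | hne
    · simp
    obtain ⟨s, hs⟩ := Nat.exists_eq_succ_of_ne_zero hne.card_ne_zero
    simpa [hs, middleChooseSum_zero_succ] using hC.card_filter_mem_le_one hF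
  | succ m ih =>
    rcases C.eq_empty_or_nonempty with rfl | hne
    · simp
    obtain ⟨t, ht⟩ : Tᶜ.Nonempty := Finset.card_pos.1 (by omega)
    have htC : ∀ A ∈ C, t ∉ A := fun A hA h ↦ Finset.mem_compl.1 ht (hCT A hA h)
    obtain ⟨C₁, C₂, h₁, h₂, hcard₁, hcard₂, hunion⟩ := hC.exists_doubling (hJ t) hne htC
    have hsub : ∀ A ∈ C₁ ∪ C₂, A ⊆ insert t T := by
      rw [hunion, Finset.forall_mem_union, Finset.forall_mem_image]
      exact ⟨fun A hA ↦ (hCT A hA).trans (Finset.subset_insert t T),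
        fun A hA ↦ Finset.insert_subset_insert t (hCT A hA)⟩
    have hcover : F.filter (· ∩ T ∈ C) ⊆
        F.filter (· ∩ insert t T ∈ C₁) ∪ F.filter (· ∩ insert t T ∈ C₂) := by
      simp only [← Finset.filter_or, ← Finset.mem_union, hunion]
      refine Finset.monotone_filter_right F fun A _ hA ↦ ?_
      by_cases htA : t ∈ A
      · rw [Finset.inter_insert_of_mem htA]
        exact Finset.mem_union_right _ (Finset.mem_image_of_mem _ hA)
      · rw [Finset.inter_insert_of_notMem htA]
        exact Finset.mem_union_left _ hA
    have hm' : (insert t T)ᶜ.card = m := by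
      rw [Finset.compl_insert, Finset.card_erase_of_mem ht, hm, Nat.add_sub_cancel]
    obtain ⟨s, hs⟩ := Nat.exists_eq_succ_of_ne_zero hne.card_ne_zero
    calc (F.filter (· ∩ T ∈ C)).card
        ≤ (F.filter (· ∩ insert t T ∈ C₁)).card + (F.filter (· ∩ insert t T ∈ C₂)).card :=
          (Finset.card_le_card hcover).trans (Finset.card_union_le _ _)
      _ ≤ middleChooseSum m C₁.card + middleChooseSum m C₂.card :=
          add_le_add (ih h₁ (fun A hA ↦ hsub A (Finset.mem_union_left _ hA)) hm')
            (ih h₂ (fun A hA ↦ hsub A (Finset.mem_union_right _ hA)) hm')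
      _ = middleChooseSum (m + 1) C.card := by
          rw [hcard₁, hcard₂, hs, middleChooseSum_succ_succ]
          rfl

end IsFormChain

end Form

section Switching

open Matrix

section

variable {ι : Type*} [DecidableEq ι]

/-- The sign `1 - 2 x i` of the coordinate `i` at the vertex `x` that corresponds to `A`, which is
the change of the `i`-th coordinate along the edge from this vertex in direction `i`. -/
def vertexSign (A : Finset ι) (i : ι) : ℝ := if i ∈ A then -1 else 1

/-- The matrix obtained from `J` by changing the signs of the rows and columns indexed by `S`. It
represents the form of `J` in the coordinates given by the automorphism `A ↦ A ∆ S` of the cube. -/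
def switchMatrix (S : Finset ι) (J : Matrix ι ι ℝ) : Matrix ι ι ℝ :=
  of fun i j ↦ vertexSign S i * vertexSign S j * J i j

lemma switchMatrix_apply (S : Finset ι) (J : Matrix ι ι ℝ) (i j : ι) :
    switchMatrix S J i j = vertexSign S i * vertexSign S j * J i j := rfl

lemma vertexSign_mul_self (S : Finset ι) (i : ι) : vertexSign S i * vertexSign S i = 1 := by
  by_cases h : i ∈ S <;> simp [vertexSign, h]

variable {J : Matrix ι ι ℝ}

lemma switchMatrix_apply_self (S : Finset ι) (i : ι) : switchMatrix S J i i = J i i := by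
  rw [switchMatrix_apply, vertexSign_mul_self, one_mul]

lemma switchMatrix_neg (S : Finset ι) : switchMatrix S (-J) = -switchMatrix S J := by
  ext i j
  simp [switchMatrix_apply]

lemma switchMatrix_compl [Fintype ι] (S : Finset ι) : switchMatrix Sᶜ J = switchMatrix S J := by
  have h : ∀ i, vertexSign Sᶜ i = -vertexSign S i := fun i ↦ by
    by_cases hi : i ∈ S <;> simp [vertexSign, hi]
  ext i j
  rw [switchMatrix_apply, switchMatrix_apply, h, h, neg_mul_neg]

lemma switchMatrix_inter_apply {S T : Finset ι} {i j : ι} (hi : i ∈ T) (hj : j ∈ T) :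
    switchMatrix (S ∩ T) J i j = switchMatrix S J i j := by
  simp [switchMatrix_apply, vertexSign, hi, hj]

lemma switchMatrix_isSymm (hJ : J.IsSymm) (S : Finset ι) : (switchMatrix S J).IsSymm :=
  IsSymm.ext fun i j ↦ by
    rw [switchMatrix_apply, switchMatrix_apply, hJ.apply, mul_comm (vertexSign S j)]

lemma switchMatrix_mul_mul (S : Finset ι) (i j k : ι) :
    switchMatrix S J i j * switchMatrix S J i k * switchMatrix S J j k =
      J i j * J i k * J j k := by
  simp only [switchMatrix_apply]
  linear_combination J i j * J i k * J j k * (vertexSign S j * vertexSign S j *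
    (vertexSign S k * vertexSign S k) * vertexSign_mul_self S i +
    vertexSign S k * vertexSign S k * vertexSign_mul_self S j + vertexSign_mul_self S k)

/-- Switching at the negative neighbours of `o` makes the row of `o` nonnegative, and the sign of a
triple product, which is invariant under switching, then determines the sign of the third entry. -/
lemma exists_switchMatrix_root_nonneg [Finite ι] (J : Matrix ι ι ℝ) (o : ι) :
    ∃ S, (∀ i ≠ o, 0 ≤ switchMatrix S J o i) ∧ ∀ i ≠ o, ∀ j ≠ o, J o i ≠ 0 → J o j ≠ 0 →
      0 ≤ J o i * J o j * J i j → 0 ≤ switchMatrix S J i j := by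
  cases nonempty_fintype ι
  set S := Finset.univ.filter fun i ↦ i ≠ o ∧ J o i < 0 with hS
  have hrow : ∀ i ≠ o, switchMatrix S J o i = |J o i| := fun i hi ↦ by
    rcases lt_or_ge (J o i) 0 with h | h
    · simp [switchMatrix_apply, vertexSign, hS, hi, h, abs_of_neg h]
    · simp [switchMatrix_apply, vertexSign, hS, h.not_gt, abs_of_nonneg h]
  refine ⟨S, fun i hi ↦ hrow i hi ▸ abs_nonneg _, fun i hi j hj hi0 hj0 h ↦ ?_⟩
  rw [← switchMatrix_mul_mul S, hrow i hi, hrow j hj] at h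
  exact nonneg_of_mul_nonneg_right h (mul_pos (abs_pos.2 hi0) (abs_pos.2 hj0))

lemma exists_switchMatrix_nonpos [Finite ι] (hJ : J.IsSymm) (hd : ∀ i, J i i ≤ 0)
    (h : ∀ i j k, i ≠ j → i ≠ k → j ≠ k → J i j * J i k * J j k < 0) :
    ∃ S, ∀ i j, switchMatrix S J i j ≤ 0 := by
  rcases isEmpty_or_nonempty ι with hι | ⟨⟨o⟩⟩
  · exact ⟨∅, fun i ↦ hι.elim i⟩
  obtain ⟨S, hrow, hpair⟩ := exists_switchMatrix_root_nonneg (-J) o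
  simp only [switchMatrix_neg, Matrix.neg_apply, neg_nonneg, ne_eq, neg_eq_zero, neg_mul,
    mul_neg, neg_neg] at hrow hpair
  refine ⟨S, fun i j ↦ ?_⟩
  rcases eq_or_ne i j with rfl | hij
  · exact (switchMatrix_apply_self S i).trans_le (hd i)
  rcases eq_or_ne i o with rfl | hi
  · exact hrow j hij.symm
  rcases eq_or_ne j o with rfl | hj
  · exact ((switchMatrix_isSymm hJ S).apply j i).trans_le (hrow i hij)
  have hoij := h o i j hi.symm hj.symm hij
  have hrow_ne : J o i * J o j ≠ 0 := left_ne_zero_of_mul hoij.ne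
  exact hpair i hi j hj (left_ne_zero_of_mul hrow_ne) (right_ne_zero_of_mul hrow_ne) hoij.le

lemma exists_switchMatrix_triple_nonneg_of_root [Finite ι] {i j k : ι} (hij : i ≠ j) (hik : i ≠ k)
    (h : 0 ≤ J i j * J i k * J j k) (hroot : J i j ≠ 0 ∧ J i k ≠ 0 ∨ J j k = 0) :
    ∃ S, 0 ≤ switchMatrix S J i j ∧ 0 ≤ switchMatrix S J i k ∧ 0 ≤ switchMatrix S J j k := by
  obtain ⟨S, hrow, hpair⟩ := exists_switchMatrix_root_nonneg J i
  refine ⟨S, hrow j hij.symm, hrow k hik.symm, ?_⟩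
  rcases hroot with ⟨hij0, hik0⟩ | hjk0
  · exact hpair j hij.symm k hik.symm hij0 hik0 h
  · simp [switchMatrix_apply, hjk0]

lemma exists_switchMatrix_triple_nonneg [Finite ι] (hJ : J.IsSymm) {i j k : ι} (hij : i ≠ j)
    (hik : i ≠ k) (hjk : j ≠ k) (h : 0 ≤ J i j * J i k * J j k) :
    ∃ S, 0 ≤ switchMatrix S J i j ∧ 0 ≤ switchMatrix S J i k ∧ 0 ≤ switchMatrix S J j k := by
  have hsymm (S : Finset ι) (a b : ι) : switchMatrix S J a b = switchMatrix S J b a :=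
    (switchMatrix_isSymm hJ S).apply b a
  by_cases hij0 : J i j = 0
  · obtain ⟨S, hki, hkj, hijS⟩ := exists_switchMatrix_triple_nonneg_of_root (J := J) hik.symm
      hjk.symm (by simp [hij0]) (Or.inr hij0)
    exact ⟨S, hijS, hsymm S i k ▸ hki, hsymm S j k ▸ hkj⟩
  by_cases hik0 : J i k = 0
  · obtain ⟨S, hji, hjkS, hikS⟩ := exists_switchMatrix_triple_nonneg_of_root (J := J) hij.symm
      hjk (by simp [hik0]) (Or.inr hik0)
    exact ⟨S, hsymm S i j ▸ hji, hikS, hjkS⟩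
  exact exists_switchMatrix_triple_nonneg_of_root hij hik h (Or.inl ⟨hij0, hik0⟩)

end

variable {n : ℕ} {J : Matrix (Fin n) (Fin n) ℝ}

lemma cubeVertex_symmDiff_sub (A B S : Finset (Fin n)) (i : Fin n) :
    cubeVertex (A ∆ S) i - cubeVertex (B ∆ S) i =
      vertexSign S i * (cubeVertex A i - cubeVertex B i) := by
  by_cases hA : i ∈ A <;> by_cases hB : i ∈ B <;> by_cases hS : i ∈ S <;>
    simp [cubeVertex, vertexSign, Finset.mem_symmDiff, hA, hB, hS]

lemma differenceForm_symmDiff (A B S : Finset (Fin n)) :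
    differenceForm J (A ∆ S) (B ∆ S) = differenceForm (switchMatrix S J) A B := by
  simp only [differenceForm, dotProduct, mulVec, Pi.sub_apply, cubeVertex_symmDiff_sub,
    switchMatrix_apply, Finset.mul_sum]
  exact Finset.sum_congr rfl fun i _ ↦ Finset.sum_congr rfl fun j _ ↦ by ring

lemma cubeVertex_mono {A B : Finset (Fin n)} (h : A ⊆ B) : cubeVertex A ≤ cubeVertex B := by
  intro i
  by_cases hA : i ∈ A
  · simp [cubeVertex, hA, h hA]
  · by_cases hB : i ∈ B <;> simp [cubeVertex, hA, hB]

lemma differenceForm_nonpos_of_subset (hJ : ∀ i j, J i j ≤ 0) {A B : Finset (Fin n)} (h : A ⊆ B) :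
    differenceForm J B A ≤ 0 := by
  have hz (i : Fin n) : 0 ≤ (cubeVertex B - cubeVertex A) i := sub_nonneg.2 (cubeVertex_mono h i)
  have hJz (i : Fin n) : (J *ᵥ (cubeVertex B - cubeVertex A)) i ≤ 0 := by
    rw [mulVec, dotProduct]
    exact Finset.sum_nonpos fun j _ ↦ mul_nonpos_of_nonpos_of_nonneg (hJ i j) (hz j)
  rw [differenceForm, dotProduct]
  exact Finset.sum_nonpos fun i _ ↦ mul_nonpos_of_nonneg_of_nonpos (hz i) (hJz i)

lemma isAntichain_image_symmDiff {S : Finset (Fin n)} (hS : ∀ i j, switchMatrix S J i j ≤ 0)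
    {F : Set (Finset (Fin n))} (hF : F.Pairwise fun A B ↦ 0 < differenceForm J A B) :
    IsAntichain (· ⊆ ·) ((· ∆ S) '' F) := by
  rintro _ ⟨A, hA, rfl⟩ _ ⟨B, hB, rfl⟩ hne hsub
  refine (hF hB hA fun h ↦ hne (h ▸ rfl)).not_ge ?_
  simpa only [← differenceForm_symmDiff, symmDiff_symmDiff_cancel_right] using
    differenceForm_nonpos_of_subset hS hsub

end Switching

section Triples

open Matrix

/-- The family of all subsets of `T` with at most one element, that is, the ball of radius one about
the empty set in the cube of subsets of `T`. -/
def cubeStar {ι : Type*} [DecidableEq ι] (T : Finset ι) : Finset (Finset ι) :=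
  insert ∅ (T.image singleton)

section

variable {ι : Type*} [DecidableEq ι] {T X : Finset ι}

lemma mem_cubeStar : X ∈ cubeStar T ↔ X ⊆ T ∧ X.card ≤ 1 := by
  rw [cubeStar, Finset.mem_insert, Finset.mem_image, Nat.le_one_iff_eq_zero_or_eq_one,
    Finset.card_eq_zero, Finset.card_eq_one]
  constructor
  · rintro (rfl | ⟨i, hi, rfl⟩)
    · simp
    · simp [hi]
  · rintro ⟨hX, rfl | ⟨i, rfl⟩⟩
    · exact Or.inl rfl
    · exact Or.inr ⟨i, Finset.singleton_subset_iff.1 hX, rfl⟩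

lemma card_cubeStar (T : Finset ι) : (cubeStar T).card = T.card + 1 := by
  rw [cubeStar, Finset.card_insert_of_notMem (by simp),
    Finset.card_image_of_injective T Finset.singleton_injective]

/-- The radius-one balls about two antipodal vertices cover the three-dimensional cube. -/
lemma inter_symmDiff_mem_cubeStar_or_compl [Fintype ι] (hT : T.card = 3) (A S : Finset ι) :
    (A ∩ T) ∆ (S ∩ T) ∈ cubeStar T ∨ (A ∩ T) ∆ (Sᶜ ∩ T) ∈ cubeStar T := by
  have hcompl : (A ∩ T) ∆ (Sᶜ ∩ T) = T \ (A ∩ T) ∆ (S ∩ T) := by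
    ext i
    simp only [Finset.mem_symmDiff, Finset.mem_inter, Finset.mem_sdiff, Finset.mem_compl]
    tauto
  have hsub : (A ∩ T) ∆ (S ∩ T) ⊆ T :=
    symmDiff_le (Finset.inter_subset_right.trans le_sup_right)
      (Finset.inter_subset_right.trans le_sup_right)
  have hcard := Finset.card_sdiff_add_card_eq_card hsub
  rw [hcompl, mem_cubeStar, mem_cubeStar, and_iff_right hsub, and_iff_right Finset.sdiff_subset]
  omega

end

variable {n : ℕ} {J : Matrix (Fin n) (Fin n) ℝ}

lemma cubeVertex_empty : cubeVertex (∅ : Finset (Fin n)) = 0 := by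
  ext i
  simp [cubeVertex]

lemma cubeVertex_singleton (a : Fin n) : cubeVertex {a} = Pi.single a 1 := by
  ext i
  simp [cubeVertex, Pi.single_apply]

lemma differenceForm_singleton_empty (a : Fin n) : differenceForm J {a} ∅ = J a a := by
  simp [differenceForm, cubeVertex_empty, cubeVertex_singleton]

lemma differenceForm_singleton_singleton (a b : Fin n) :
    differenceForm J {a} {b} = J a a + J b b - J a b - J b a := by
  simp only [differenceForm, cubeVertex_singleton, mulVec_sub, mulVec_single, MulOpposite.op_one,
    one_smul, dotProduct_sub, sub_dotProduct, single_dotProduct, col_apply, one_mul]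
  ring

lemma isFormChain_cubeStar (hd : ∀ i, J i i ≤ 0) {T : Finset (Fin n)}
    (hT : (T : Set (Fin n)).Pairwise fun a b ↦ 0 ≤ J a b) : IsFormChain J (cubeStar T) := by
  have hsingleton : IsFormChain J (T.image singleton) := by
    simp only [IsFormChain, Finset.forall_mem_image]
    intro a ha b hb
    rcases eq_or_ne a b with rfl | hab
    · exact (differenceForm_self {a}).le
    · rw [differenceForm_singleton_singleton]
      linarith [hd a, hd b, hT ha hb hab, hT hb ha hab.symm]
  refine hsingleton.insert_of_forall_le ?_
  rw [Finset.forall_mem_image]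
  exact fun a _ ↦ (differenceForm_singleton_empty a).trans_le (hd a)

lemma IsFormChain.image_symmDiff {S : Finset (Fin n)} {C : Finset (Finset (Fin n))}
    (hC : IsFormChain (switchMatrix S J) C) : IsFormChain J (C.image (· ∆ S)) := by
  simpa only [IsFormChain, Finset.forall_mem_image, differenceForm_symmDiff] using hC

variable {F : Finset (Finset (Fin n))}

lemma card_filter_mem_cubeStar_le (hd : ∀ i, J i i ≤ 0)
    (hF : (F : Set (Finset (Fin n))).Pairwise fun A B ↦ 0 < differenceForm J A B)
    {S T : Finset (Fin n)} (hT : (T : Set (Fin n)).Pairwise fun a b ↦ 0 ≤ switchMatrix S J a b) :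
    (F.filter fun A ↦ (A ∩ T) ∆ (S ∩ T) ∈ cubeStar T).card ≤
      middleChooseSum Tᶜ.card (T.card + 1) := by
  have hT' : (T : Set (Fin n)).Pairwise fun a b ↦ 0 ≤ switchMatrix (S ∩ T) J a b :=
    fun a ha b hb hab ↦ by
      simpa only [switchMatrix_inter_apply ha hb] using hT ha hb hab
  have hd' (i : Fin n) : switchMatrix (S ∩ T) J i i ≤ 0 :=
    (switchMatrix_apply_self _ i).trans_le (hd i)
  have hchain : IsFormChain J ((cubeStar T).image (· ∆ (S ∩ T))) :=
    (isFormChain_cubeStar hd' hT').image_symmDiff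
  have hsub : ∀ A ∈ (cubeStar T).image (· ∆ (S ∩ T)), A ⊆ T := by
    rw [Finset.forall_mem_image]
    exact fun A hA ↦ symmDiff_le ((mem_cubeStar.1 hA).1.trans le_sup_right)
      (Finset.inter_subset_right.trans le_sup_right)
  have hcard : ((cubeStar T).image (· ∆ (S ∩ T))).card = T.card + 1 := by
    rw [Finset.card_image_of_injective _ (symmDiff_left_injective _), card_cubeStar]
  rw [← hcard]
  refine le_trans (Finset.card_le_card (Finset.monotone_filter_right F fun A _ hA ↦ ?_))
    (hchain.card_filter_inter_mem_le hd hF hsub)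
  exact Finset.mem_image.2 ⟨_, hA, symmDiff_symmDiff_cancel_right _ _⟩

lemma card_le_two_mul_middleChooseSum (hd : ∀ i, J i i ≤ 0)
    (hF : (F : Set (Finset (Fin n))).Pairwise fun A B ↦ 0 < differenceForm J A B)
    {S T : Finset (Fin n)} (hT : T.card = 3)
    (hS : (T : Set (Fin n)).Pairwise fun a b ↦ 0 ≤ switchMatrix S J a b) :
    F.card ≤ 2 * middleChooseSum (n - 3) 4 := by
  have hTc : Tᶜ.card = n - 3 := by rw [Finset.card_compl, hT, Fintype.card_fin]
  have hbound := card_filter_mem_cubeStar_le hd hF hS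
  have hbound_compl := card_filter_mem_cubeStar_le hd hF (switchMatrix_compl (J := J) S ▸ hS)
  simp only [hTc, hT, Nat.reduceAdd] at hbound hbound_compl
  have hcover : F ⊆ F.filter (fun A ↦ (A ∩ T) ∆ (S ∩ T) ∈ cubeStar T) ∪
      F.filter fun A ↦ (A ∩ T) ∆ (Sᶜ ∩ T) ∈ cubeStar T := fun A hA ↦ by
    rw [← Finset.filter_or]
    exact Finset.mem_filter.2 ⟨hA, inter_symmDiff_mem_cubeStar_or_compl hT A S⟩
  have hle := (Finset.card_le_card hcover).trans (Finset.card_union_le _ _)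
  omega

lemma card_le_of_triple_nonneg (hJ : J.IsSymm) (hd : ∀ i, J i i ≤ 0)
    (hF : (F : Set (Finset (Fin n))).Pairwise fun A B ↦ 0 < differenceForm J A B)
    {i j k : Fin n} (hij : i ≠ j) (hik : i ≠ k) (hjk : j ≠ k) (h : 0 ≤ J i j * J i k * J j k) :
    (F.card : ℝ) ≤
      (1 - 1 / ((n : ℝ) - (if Odd n then 0 else 1))) * (n.choose (n / 2) : ℝ) := by
  obtain ⟨S, hSij, hSik, hSjk⟩ := exists_switchMatrix_triple_nonneg hJ hij hik hjk h
  have hT : ({i, j, k} : Finset (Fin n)).card = 3 :=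
    Finset.card_eq_three.2 ⟨i, j, k, hij, hik, hjk, rfl⟩
  have hS : (({i, j, k} : Finset (Fin n)) : Set (Fin n)).Pairwise
      fun a b ↦ 0 ≤ switchMatrix S J a b := by
    have hsymm : Std.Symm fun a b ↦ 0 ≤ switchMatrix S J a b :=
      ⟨fun a b hab ↦ ((switchMatrix_isSymm hJ S).apply a b).symm ▸ hab⟩
    simp [Set.pairwise_insert_of_symm, hSij, hSik, hSjk]
  have hn : 3 ≤ n := by simpa [hT] using Finset.card_le_univ ({i, j, k} : Finset (Fin n))
  have hcard := card_le_two_mul_middleChooseSum hd hF hT hS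
  calc (F.card : ℝ) ≤ (2 * middleChooseSum (n - 3) 4 : ℕ) := by exact_mod_cast hcard
    _ = _ := by rw [two_mul_middleChooseSum_four, Nat.sub_add_cancel hn]

end Triples

section LocalMaxima

open Matrix MvPolynomial

lemma eval_monomial_eq_toMultiset_prod {σ R : Type*} [CommSemiring R] (s : σ →₀ ℕ) (a : R)
    (x : σ → R) : eval x (monomial s a) = a * (s.toMultiset.map x).prod := by
  rw [eval_monomial, Finsupp.toMultiset_map, Finsupp.prod_toMultiset,
    Finsupp.prod_mapDomain_index (fun _ ↦ pow_zero _) fun _ _ _ ↦ pow_add _ _ _]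

lemma exists_quadratic_of_totalDegree_le_two {σ R : Type*} [Fintype σ] [CommSemiring R]
    {Θ : MvPolynomial σ R} (hΘ : Θ.totalDegree ≤ 2) :
    ∃ (c : R) (b : σ → R) (M : Matrix σ σ R), ∀ x, eval x Θ = c + b ⬝ᵥ x + x ⬝ᵥ (M *ᵥ x) := by
  classical
  rw [Θ.as_sum]
  refine Finset.sum_induction _ (fun p : MvPolynomial σ R ↦ ∃ (c : R) (b : σ → R)
    (M : Matrix σ σ R), ∀ x, eval x p = c + b ⬝ᵥ x + x ⬝ᵥ (M *ᵥ x)) ?_ ⟨0, 0, 0, by simp⟩ ?_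
  · rintro p q ⟨c, b, M, hp⟩ ⟨c', b', M', hq⟩
    refine ⟨c + c', b + b', M + M', fun x ↦ ?_⟩
    rw [map_add, hp, hq, add_dotProduct, add_mulVec, dotProduct_add]
    ring
  · intro s hs
    have hcard : s.toMultiset.card ≤ 2 := by
      rw [Finsupp.card_toMultiset]
      exact (le_totalDegree hs).trans hΘ
    simp only [eval_monomial_eq_toMultiset_prod]
    obtain h | h | h : s.toMultiset.card = 0 ∨ s.toMultiset.card = 1 ∨ s.toMultiset.card = 2 := by
      omega
    · exact ⟨coeff s Θ, 0, 0, fun x ↦ by simp [Multiset.card_eq_zero.1 h]⟩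
    · obtain ⟨i, hi⟩ := Multiset.card_eq_one.1 h
      exact ⟨0, Pi.single i (coeff s Θ), 0, fun x ↦ by simp [hi]⟩
    · obtain ⟨i, j, hij⟩ := Multiset.card_eq_two.1 h
      refine ⟨0, 0, Matrix.single i j (coeff s Θ), fun x ↦ ?_⟩
      have hrow : Matrix.single i j (coeff s Θ) *ᵥ x = Pi.single i (coeff s Θ * x j) :=
        single_mulVec i j _ x
      simp only [hij, Multiset.insert_eq_cons, Multiset.map_cons, Multiset.map_singleton,
        Multiset.prod_cons, Multiset.prod_singleton, zero_dotProduct, add_zero, hrow,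
        dotProduct_single, zero_add]
      ring

variable {n : ℕ} {Θ : MvPolynomial (Fin n) ℝ}

/-- On the cube `x i ^ 2 = x i`, which turns the diagonal of a quadratic form into a linear form. -/
lemma exists_eval_cubeVertex_eq (hΘ : Θ.totalDegree ≤ 2) :
    ∃ (c : ℝ) (b : Fin n → ℝ) (M : Matrix (Fin n) (Fin n) ℝ), (∀ i, M i i = 0) ∧
      ∀ A, eval (cubeVertex A) Θ =
        c + b ⬝ᵥ cubeVertex A + cubeVertex A ⬝ᵥ (M *ᵥ cubeVertex A) := by
  obtain ⟨c, b, M, hM⟩ := exists_quadratic_of_totalDegree_le_two hΘ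
  refine ⟨c, b + M.diag, M - diagonal M.diag, fun i ↦ by simp, fun A ↦ ?_⟩
  have hdiag : cubeVertex A ⬝ᵥ (diagonal M.diag *ᵥ cubeVertex A) = M.diag ⬝ᵥ cubeVertex A := by
    refine Finset.sum_congr rfl fun i _ ↦ ?_
    rw [mulVec_diagonal]
    by_cases hi : i ∈ A <;> simp [cubeVertex, hi]
  rw [hM, sub_mulVec, dotProduct_sub, hdiag, add_dotProduct]
  ring

lemma cubeVertex_symmDiff_singleton (A : Finset (Fin n)) (i : Fin n) :
    cubeVertex (A ∆ {i}) = cubeVertex A + Pi.single i (vertexSign A i) := by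
  ext j
  rcases eq_or_ne j i with rfl | hj
  · by_cases h : j ∈ A <;> simp [cubeVertex, vertexSign, Finset.mem_symmDiff, h]
  · by_cases h : j ∈ A <;> simp [cubeVertex, Finset.mem_symmDiff, h, hj]

/-- The left-hand side of the conclusion is the change of `Θ` along the edge in direction `i`. -/
lemma IsStrictLocalMaxOnCube.vertexSign_mul_neg {c : ℝ} {b : Fin n → ℝ}
    {M : Matrix (Fin n) (Fin n) ℝ} (hM : ∀ i, M i i = 0)
    (hΘ : ∀ A, eval (cubeVertex A) Θ =
      c + b ⬝ᵥ cubeVertex A + cubeVertex A ⬝ᵥ (M *ᵥ cubeVertex A))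
    {A : Finset (Fin n)} (hA : IsStrictLocalMaxOnCube Θ A) (i : Fin n) :
    vertexSign A i * (b i + ((M + Mᵀ) *ᵥ cubeVertex A) i) < 0 := by
  have hlt := hA (A ∆ {i}) (by simp [CubeAdj])
  rw [hΘ, hΘ, cubeVertex_symmDiff_singleton, add_single_dotProduct_mulVec, dotProduct_add,
    dotProduct_single, hM] at hlt
  linarith

lemma differenceForm_pos_of_vertexSign_mul_neg {b : Fin n → ℝ} {J : Matrix (Fin n) (Fin n) ℝ}
    {A B : Finset (Fin n)} (hA : ∀ i, vertexSign A i * (b i + (J *ᵥ cubeVertex A) i) < 0)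
    (hB : ∀ i, vertexSign B i * (b i + (J *ᵥ cubeVertex B) i) < 0) (hAB : A ≠ B) :
    0 < differenceForm J A B := by
  have hpos : ∀ i, (i ∈ A ↔ i ∉ B) → 0 < (cubeVertex A - cubeVertex B) i *
      (J *ᵥ (cubeVertex A - cubeVertex B)) i := fun i hi ↦ by
    have hAi := hA i
    have hBi := hB i
    rw [mulVec_sub, Pi.sub_apply, Pi.sub_apply]
    by_cases hiB : i ∈ B
    · simp only [vertexSign, cubeVertex, hi, hiB, not_true_eq_false, if_true, if_false] at hAi hBi ⊢
      linarith
    · simp only [vertexSign, cubeVertex, hi, hiB, not_false_eq_true, if_true, if_false] at hAi hBi ⊢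
      linarith
  obtain ⟨i, hi⟩ : ∃ i, (i ∈ A ↔ i ∉ B) := by
    by_contra! h
    exact hAB (Finset.ext fun i ↦ by have := h i; tauto)
  refine Finset.sum_pos' (fun j _ ↦ ?_) ⟨i, Finset.mem_univ i, hpos i hi⟩
  by_cases hj : j ∈ A ↔ j ∉ B
  · exact (hpos j hj).le
  · have : j ∈ A ↔ j ∈ B := by tauto
    simp [cubeVertex, this]

lemma exists_differenceForm_pos_on_localMaxima (hΘ : Θ.totalDegree ≤ 2) :
    ∃ J : Matrix (Fin n) (Fin n) ℝ, J.IsSymm ∧ (∀ i, J i i = 0) ∧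
      (localMaxima Θ).Pairwise fun A B ↦ 0 < differenceForm J A B := by
  obtain ⟨c, b, M, hM, hΘM⟩ := exists_eval_cubeVertex_eq hΘ
  exact ⟨M + Mᵀ, isSymm_add_transpose_self M, fun i ↦ by simp [hM], fun A hA B hB ↦
    differenceForm_pos_of_vertexSign_mul_neg (IsStrictLocalMaxOnCube.vertexSign_mul_neg hM hΘM hA)
      (IsStrictLocalMaxOnCube.vertexSign_mul_neg hM hΘM hB)⟩

end LocalMaxima

theorem theorem4 (n : ℕ) (Θ : MvPolynomial (Fin n) ℝ) (hΘ : Θ.totalDegree ≤ 2)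
    (hmax : (1 - 1 / ((n : ℝ) - (if Odd n then 0 else 1))) * (n.choose (n / 2) : ℝ)
      < ((localMaxima Θ).ncard : ℝ)) :
    ∃ S : Finset (Fin n),
      IsAntichain (· ⊆ ·) ((fun A : Finset (Fin n) => A ∆ S) '' localMaxima Θ) := by
  obtain ⟨J, hJ, hdiag, hpos⟩ := exists_differenceForm_pos_on_localMaxima hΘ
  have hd (i : Fin n) : J i i ≤ 0 := (hdiag i).le
  have htriple : ∀ i j k, i ≠ j → i ≠ k → j ≠ k → J i j * J i k * J j k < 0 := by
    intro i j k hij hik hjk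
    by_contra! h
    obtain ⟨F, hF⟩ := (localMaxima Θ).toFinite.exists_finset_coe
    rw [← hF] at hpos hmax
    rw [Set.ncard_coe_finset] at hmax
    exact hmax.not_ge (card_le_of_triple_nonneg hJ hd hpos hij hik hjk h)
  obtain ⟨S, hS⟩ := exists_switchMatrix_nonpos hJ hd htriple
  exact ⟨S, isAntichain_image_symmDiff hS hpos⟩
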